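/- Let $Q_n$ denote the $n$-cube, i.e. the graph on $\{0,1\}^n$ in which two sequences are adjacent iff they differ in exactly one coordinate. A $d$-subcube of $Q_n$ is a set $C\subseteq\{0,1\}^n$ whose induced subgraph $Q_n[C]$ is isomorphic to $Q_d$; there are exactly $\binom nd 2^{n-d}$ of them. For $H\subseteq\{0,1\}^d$ and $S\subseteq\{0,1\}^n$, a $d$-subcube $C$ gives a copy of $H$ in $S$ if there is a graph isomorphism $f$ from $Q_d$ to $Q_n[C]$ with $f(H)=S\cap C$. Let $\Lambda(H,S)$ be the number of $d$-subcubes $C$ that give a copy of $H$ in $S$, let $\Lambda(H,n)=\max\{\Lambda(H,S) : S\subseteq\{0,1\}^n\}$, and let the inducibility constant of $H$ be $$\lambda(H)=\lim_{n\to\infty}\frac{\Lambda(H,n)}{\binom nd\,2^{n-d}}.$$ Consider the following subsets of $\{0,1\}^3$: \begin{align*} W_7&=\{(0,0,0),(1,1,1)\},\\ W_8&=\{(0,0,1),(0,1,0),(1,0,0)\},\\ W_9&=\{(0,0,0),(0,0,1),(0,1,0),(1,1,1)\},\\ W_{10}&=\{(0,0,0),(0,0,1),(1,1,1)\},\\ W_{12}&=\{(0,0,0),(0,0,1),(0,1,0),(1,0,0)\}.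 \end{align*} Then the limits defining the inducibility constants of these five configurations exist, and $$\lambda(W_7)=\tfrac13,\qquad \lambda(W_8)=\tfrac23,\qquad \lambda(W_9)=\tfrac49,\qquad \lambda(W_{10})=\tfrac5{12},\qquad \lambda(W_{12})=\tfrac12.$$ -/

import Mathlib

namespace Hypercube

/-- The `n`-cube `Q_n`: the graph on binary sequences of length `n` in which two sequences are
adjacent iff they differ in exactly one coordinate. -/
def cube (n : ℕ) : SimpleGraph (Fin n → Fin 2) where
  Adj x y := hammingDist x y = 1
  symm := ⟨fun x y h => by rw [hammingDist_comm]; exact h⟩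
  loopless := ⟨fun x h => by simp at h⟩

/-- `C` is a `d`-subcube of `Q_n` that gives a copy of `H ⊆ {0,1}^d` in `S ⊆ {0,1}^n`: there is a
graph isomorphism `f` from `Q_d` to the subgraph of `Q_n` induced by `C` with `f(H) = S ∩ C`. -/
def GivesCopy {d n : ℕ} (H : Set (Fin d → Fin 2)) (S C : Set (Fin n → Fin 2)) : Prop :=
  ∃ f : cube d ≃g (cube n).induce C, (fun x => (f x : Fin n → Fin 2)) '' H = S ∩ C

/-- `Λ(H, S)`: the number of copies of `H` in `S`, that is, the number of vertex sets `C` of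
`d`-subcubes giving a copy of `H` in `S`. -/
noncomputable def copyCount {d n : ℕ} (H : Set (Fin d → Fin 2)) (S : Set (Fin n → Fin 2)) : ℕ :=
  {C : Set (Fin n → Fin 2) | GivesCopy H S C}.ncard

/-- The inducibility function `Λ(H, n)`: the maximum of `Λ(H, S)` over all `S ⊆ {0,1}^n`. -/
noncomputable def inducibility {d : ℕ} (H : Set (Fin d → Fin 2)) (n : ℕ) : ℕ :=
  (Finset.univ : Finset (Finset (Fin n → Fin 2))).sup
    fun S => copyCount H (S : Set (Fin n → Fin 2))

/-- The inducibility constant `λ(H)`, as a relation: the ratio of `Λ(H, n)` to the number of all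
`d`-subcubes of `Q_n` converges to `c` as `n → ∞`. -/
def HasInducibilityConstant {d : ℕ} (H : Set (Fin d → Fin 2)) (c : ℝ) : Prop :=
  Filter.Tendsto
    (fun n : ℕ => (inducibility H n : ℝ) / ((n.choose d : ℝ) * 2 ^ (n - d)))
    Filter.atTop (nhds c)

def W7 : Set (Fin 3 → Fin 2) := {![0, 0, 0], ![1, 1, 1]}

def W8 : Set (Fin 3 → Fin 2) := {![0, 0, 1], ![0, 1, 0], ![1, 0, 0]}

def W9 : Set (Fin 3 → Fin 2) := {![0, 0, 0], ![0, 0, 1], ![0, 1, 0], ![1, 1, 1]}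

def W10 : Set (Fin 3 → Fin 2) := {![0, 0, 0], ![0, 0, 1], ![1, 1, 1]}

def W12 : Set (Fin 3 → Fin 2) := {![0, 0, 0], ![0, 0, 1], ![0, 1, 0], ![1, 0, 0]}

end Hypercube

/-!
A copy of `H` is counted through its frames, an origin together with a sequence of directions; every
copy has as many frames as `H` has symmetries.

Upper bounds: the sum of a function of the pattern along a frame, taken over all frames, does not
change when the function is moved by a symmetry of the cube. Two extensions of a frame by one
direction can be chosen independently, so suitable functions of the pattern on `Q_3` (on `Q_4` for
`W8`) have a sum of squares as their total. Adding such a function to the indicator of `H` does not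
decrease the total, and a bound for the orbit sums of all patterns then bounds the number of frames.

Lower bounds: for a finite abelian group `G` and a symmetric set `K` of steps, map `Q_n` to the
Cayley graph of `K` from a random start, moving along each coordinate by an independent random step.
Seen from any vertex, position and steps are again independent and uniform, so the expected number
of frames of `H` in the preimage of a set `A` is given by the local count in `G`.
-/

namespace Hypercube

open Finset

section Frames

variable {n N : ℕ}

/-- The frame of `Q_n` with origin `x` and directions `d`, as a parametrization of a subcube: the
vertex `v` of `Q_N` goes to the vertex obtained from `x` by flipping, for each `a` with `v a = 1`,
the coordinate `d a`. Directions may repeat, so that averages over all frames factor over the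
directions; the frame parametrizes an `N`-subcube iff `d` is injective. -/
def frameMap (x : Fin n → Fin 2) (d : Fin N → Fin n) (v : Fin N → Fin 2) : Fin n → Fin 2 :=
  x + ∑ a, Pi.single (d a) (v a)

theorem add_self_eq_zero (x : Fin n → Fin 2) : x + x = 0 := by
  have h : ∀ t : Fin 2, t + t = 0 := by decide
  exact funext fun i => h (x i)

@[simp] theorem frameMap_zero (x : Fin n → Fin 2) (d : Fin N → Fin n) : frameMap x d 0 = x := by
  simp [frameMap]

theorem frameMap_add (x : Fin n → Fin 2) (d : Fin N → Fin n) (u v : Fin N → Fin 2) :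
    frameMap x d (u + v) = frameMap (frameMap x d u) d v := by
  simp [frameMap, Pi.single_add, sum_add_distrib, add_assoc]

theorem frameMap_comp_perm (x : Fin n → Fin 2) (d : Fin N → Fin n) (π : Equiv.Perm (Fin N))
    (v : Fin N → Fin 2) : frameMap x (d ∘ π) v = frameMap x d (v ∘ π.symm) :=
  congrArg (x + ·) (Fintype.sum_equiv π _ _ fun a => by simp)

theorem frameMap_insertNth_zero (x : Fin n → Fin 2) (d : Fin (N + 1) → Fin n) (i : Fin (N + 1))
    (v : Fin N → Fin 2) : frameMap x d (i.insertNth 0 v) = frameMap x (d ∘ i.succAbove) v := by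
  simp [frameMap, Fin.sum_univ_succAbove _ i]

theorem frameMap_single (x : Fin n → Fin 2) (d : Fin N → Fin n) (a : Fin N) :
    frameMap x d (Pi.single a 1) = x + Pi.single (d a) 1 := by
  rw [frameMap, Fintype.sum_eq_single a fun b hb => by simp [Pi.single_eq_of_ne hb],
    Pi.single_eq_same]

theorem frameMap_apply (x : Fin n → Fin 2) {d : Fin N → Fin n} (hd : Function.Injective d)
    (v : Fin N → Fin 2) (a : Fin N) : frameMap x d v (d a) = x (d a) + v a := by
  rw [frameMap, Pi.add_apply, Finset.sum_apply,
    Fintype.sum_eq_single a fun b hb => Pi.single_eq_of_ne (hd.ne hb).symm _, Pi.single_eq_same]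

theorem frameMap_apply_of_notMem_range (x : Fin n → Fin 2) {d : Fin N → Fin n}
    (v : Fin N → Fin 2) {i : Fin n} (hi : i ∉ Set.range d) : frameMap x d v i = x i := by
  rw [frameMap, Pi.add_apply, Finset.sum_apply, add_eq_left]
  exact sum_eq_zero fun a _ => Pi.single_eq_of_ne (fun h => hi ⟨a, h.symm⟩) _

theorem frameMap_injective (x : Fin n → Fin 2) {d : Fin N → Fin n} (hd : Function.Injective d) :
    Function.Injective (frameMap x d) := fun v w h => funext fun a =>
  add_left_cancel (a := x (d a)) (by rw [← frameMap_apply x hd, ← frameMap_apply x hd, h])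

theorem hammingDist_frameMap (x : Fin n → Fin 2) {d : Fin N → Fin n} (hd : Function.Injective d)
    (v w : Fin N → Fin 2) : hammingDist (frameMap x d v) (frameMap x d w) = hammingDist v w := by
  rw [hammingDist, hammingDist, ← card_image_of_injective {a | v a ≠ w a} hd]
  congr 1
  ext i
  by_cases hi : i ∈ Set.range d
  · obtain ⟨a, rfl⟩ := hi
    simp [frameMap_apply x hd, hd.eq_iff]
  · have hne : ∀ a, d a ≠ i := fun a h => hi ⟨a, h⟩
    simp [frameMap_apply_of_notMem_range x _ hi, hne]

theorem cube_adj_iff {x y : Fin n → Fin 2} :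
    (cube n).Adj x y ↔ ∃ i, y = x + Pi.single i 1 := by
  have hne : ∀ s t : Fin 2, s ≠ t ↔ t = s + 1 := by decide
  have heq : ∀ s t : Fin 2, ¬ s ≠ t ↔ t = s := by decide
  simp only [cube, hammingDist, card_eq_one, Finset.ext_iff, mem_filter_univ, mem_singleton,
    funext_iff, Pi.add_apply]
  refine exists_congr fun i => forall_congr' fun j => ?_
  obtain rfl | h := eq_or_ne j i
  · simp [hne]
  · simpa [h] using heq (x j) (y j)

theorem eq_of_adj_of_adj {x y : Fin n → Fin 2} {i j : Fin n} (hij : i ≠ j)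
    (hi : (cube n).Adj (x + Pi.single i 1) y) (hj : (cube n).Adj (x + Pi.single j 1) y)
    (hy : y ≠ x) : y = x + Pi.single i 1 + Pi.single j 1 := by
  obtain ⟨k, rfl⟩ := cube_adj_iff.1 hi
  obtain ⟨l, hl⟩ := cube_adj_iff.1 hj
  have hki : k ≠ i := by
    rintro rfl
    exact hy (by rw [add_assoc, add_self_eq_zero, add_zero])
  by_cases hkj : k = j
  · rw [hkj]
  have hk := congrFun hl k
  have hi := congrFun hl i
  simp only [Pi.add_apply, Pi.single_eq_same, Pi.single_eq_of_ne hki, Pi.single_eq_of_ne hkj,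
    Pi.single_eq_of_ne hki.symm, Pi.single_eq_of_ne hij, add_zero, add_right_inj,
    Pi.single_apply] at hk hi
  split_ifs at hk hi with hkl hil
  · exact absurd (hkl.trans hil.symm) hki
  all_goals simp at hk hi

theorem sum_single_one (v : Fin n → Fin 2) : ∑ i with v i = 1, Pi.single i 1 = v := by
  have h : ∀ t : Fin 2, (if t = 1 then 1 else 0) = t := by decide
  ext1 j
  simp [Finset.sum_apply, Pi.single_apply, sum_ite_eq, h]

theorem eq_frameMap_of_single {F : (Fin N → Fin 2) → (Fin n → Fin 2)} {d : Fin N → Fin n}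
    (hF : Function.Injective F) (hadj : ∀ v w, (cube N).Adj v w → (cube n).Adj (F v) (F w))
    (hd : Function.Injective d) (hbase : ∀ a, F (Pi.single a 1) = F 0 + Pi.single (d a) 1) :
    F = frameMap (F 0) d := by
  have hstep (v a) : (cube n).Adj (F v) (F (v + Pi.single a 1)) :=
    hadj _ _ (cube_adj_iff.2 ⟨a, rfl⟩)
  have hind (s : Finset (Fin N)) :
      F (∑ c ∈ s, Pi.single c 1) = frameMap (F 0) d (∑ c ∈ s, Pi.single c 1) ∧
        ∀ a ∉ s, F (∑ c ∈ s, Pi.single c 1 + Pi.single a 1) =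
          F (∑ c ∈ s, Pi.single c 1) + Pi.single (d a) 1 := by
    induction s using Finset.induction_on with
    | empty => simpa using hbase
    | insert b s hb ih =>
      obtain ⟨hs, hsingle⟩ := ih
      simp only [sum_insert hb, mem_insert, not_or, add_comm (Pi.single b 1 : Fin N → Fin 2)]
      refine ⟨by rw [hsingle b hb, hs, frameMap_add, frameMap_single], fun a ⟨hab, ha⟩ => ?_⟩
      have hne : (Pi.single b 1 + Pi.single a 1 : Fin N → Fin 2) ≠ 0 := fun h => by
        simpa [hab] using congrFun h a
      rw [hsingle b hb]
      -- Two vertices at distance two have only two common neighbours, and one of them is taken.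
      refine eq_of_adj_of_adj (hd.ne (Ne.symm hab)) ?_ ?_ (hF.ne ?_)
      · rw [← hsingle b hb]
        exact hstep _ a
      · rw [← hsingle a ha, add_right_comm]
        exact hstep _ b
      · simpa [add_assoc] using hne
  exact funext fun v => sum_single_one v ▸ (hind _).1

theorem exists_eq_frameMap {F : (Fin N → Fin 2) → (Fin n → Fin 2)} (hF : Function.Injective F)
    (hadj : ∀ v w, (cube N).Adj v w → (cube n).Adj (F v) (F w)) :
    ∃ d : Fin N → Fin n, Function.Injective d ∧ F = frameMap (F 0) d := by
  have hbase (a) : ∃ i, F (Pi.single a 1) = F 0 + Pi.single i 1 :=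
    cube_adj_iff.1 (hadj _ _ (cube_adj_iff.2 ⟨a, (zero_add _).symm⟩))
  choose d hd using hbase
  have hinj : Function.Injective d := fun a b hab => by
    have h := hF ((hd a).trans (hab ▸ (hd b).symm))
    by_contra hne
    simpa [hne] using congrFun h a
  exact ⟨d, hinj, eq_frameMap_of_single hF hadj hinj hd⟩

theorem exists_perm_of_range_eq {x x' : Fin n → Fin 2} {d d' : Fin N → Fin n}
    (hd' : Function.Injective d') (h : Set.range (frameMap x' d') = Set.range (frameMap x d)) :
    ∃ (u : Fin N → Fin 2) (π : Equiv.Perm (Fin N)), x' = frameMap x d u ∧ d' = d ∘ π := by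
  obtain ⟨u, hu⟩ : x' ∈ Set.range (frameMap x d) := h ▸ ⟨0, frameMap_zero _ _⟩
  have hmem (a) : d' a ∈ Set.range d := by
    by_contra ha
    obtain ⟨w, hw⟩ : frameMap x' d' (Pi.single a 1) ∈ Set.range (frameMap x d) := h ▸ ⟨_, rfl⟩
    have hfix : x' (d' a) = x (d' a) := by rw [← hu, frameMap_apply_of_notMem_range x u ha]
    have hflip := congrFun hw (d' a)
    rw [frameMap_apply x' hd', frameMap_apply_of_notMem_range x w ha, hfix] at hflip
    simp at hflip
  choose f hf using hmem
  have hfi : Function.Injective f := fun a b hab => hd' (by rw [← hf, ← hf, hab])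
  exact ⟨u, Equiv.ofBijective f (Finite.injective_iff_bijective.1 hfi), hu.symm,
    funext fun a => (hf a).symm⟩

theorem frameMap_id (u v : Fin N → Fin 2) : frameMap u id v = u + v := by
  simp [frameMap, univ_sum_single]

theorem frameMap_frameMap_perm (x : Fin n → Fin 2) (d : Fin N → Fin n) (u : Fin N → Fin 2)
    (π : Equiv.Perm (Fin N)) (v : Fin N → Fin 2) :
    frameMap (frameMap x d u) (d ∘ π) v = frameMap x d (frameMap u π v) := by
  rw [frameMap_comp_perm, ← frameMap_add, ← frameMap_id, ← frameMap_comp_perm, Function.id_comp]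

theorem range_frameMap_comp_perm (x : Fin n → Fin 2) (d : Fin N → Fin n) (u : Fin N → Fin 2)
    (π : Equiv.Perm (Fin N)) :
    Set.range (frameMap (frameMap x d u) (d ∘ π)) = Set.range (frameMap x d) := by
  rw [funext (frameMap_frameMap_perm x d u π)]
  exact (Finite.surjective_of_injective (frameMap_injective u π.injective)).range_comp
    (frameMap x d)

end Frames

section Count

variable {n N : ℕ}

open Classical in
/-- The frames with distinct directions along which `S` looks like `H`. The frames of `Q_N` itself
parametrize the symmetries of `Q_N`, so `frames H H` is the stabilizer of `H`. -/
noncomputable def frames (H : Set (Fin N → Fin 2)) (S : Set (Fin n → Fin 2)) :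
    Finset ((Fin n → Fin 2) × (Fin N → Fin n)) :=
  {p | Function.Injective p.2 ∧ ∀ v, frameMap p.1 p.2 v ∈ S ↔ v ∈ H}

theorem mem_frames {H : Set (Fin N → Fin 2)} {S : Set (Fin n → Fin 2)}
    {p : (Fin n → Fin 2) × (Fin N → Fin n)} :
    p ∈ frames H S ↔ Function.Injective p.2 ∧ ∀ v, frameMap p.1 p.2 v ∈ S ↔ v ∈ H := by
  simp [frames]

theorem GivesCopy.exists_frame {H : Set (Fin N → Fin 2)} {S C : Set (Fin n → Fin 2)}
    (h : GivesCopy H S C) : ∃ p ∈ frames H S, Set.range (frameMap p.1 p.2) = C := by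
  obtain ⟨f, hf⟩ := h
  obtain ⟨d, hd, hF⟩ := exists_eq_frameMap (F := fun v => (f v : Fin n → Fin 2))
    (Subtype.val_injective.comp f.injective) (fun v w h => f.map_adj_iff.2 h)
  refine ⟨(f 0, d), mem_frames.2 ⟨hd, fun v => ?_⟩, ?_⟩
  · have hv : (f v : Fin n → Fin 2) ∈ S ∩ C ↔ v ∈ H :=
      hf ▸ (Subtype.val_injective.comp f.injective).mem_set_image
    rw [← hF, ← hv, Set.mem_inter_iff, and_iff_left (f v).2]
  · rw [← hF, Set.range_comp' Subtype.val f, f.surjective.range_eq, Set.image_univ,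
      Subtype.range_coe]

theorem givesCopy_range_frameMap {H : Set (Fin N → Fin 2)} {S : Set (Fin n → Fin 2)}
    {p : (Fin n → Fin 2) × (Fin N → Fin n)} (hp : p ∈ frames H S) :
    GivesCopy H S (Set.range (frameMap p.1 p.2)) := by
  obtain ⟨hd, hS⟩ := mem_frames.1 hp
  refine ⟨⟨Equiv.ofInjective _ (frameMap_injective p.1 hd), fun {v w} => ?_⟩, ?_⟩
  · exact (hammingDist_frameMap p.1 hd v w).congr_left
  · ext y
    constructor
    · rintro ⟨v, hv, rfl⟩
      exact ⟨(hS v).2 hv, v, rfl⟩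
    · rintro ⟨hy, v, rfl⟩
      exact ⟨v, (hS v).1 hy, rfl⟩

open Classical in
theorem copyCount_eq_card_image (H : Set (Fin N → Fin 2)) (S : Set (Fin n → Fin 2)) :
    copyCount H S = #((frames H S).image fun p => Set.range (frameMap p.1 p.2)) := by
  rw [copyCount, ← Set.ncard_coe_finset, coe_image]
  exact congrArg Set.ncard <| Set.ext fun C =>
    ⟨GivesCopy.exists_frame, fun ⟨_, hp, hC⟩ => hC ▸ givesCopy_range_frameMap hp⟩

open Classical in
/-- The frames of a given copy form an orbit of the stabilizer of `H`. -/
theorem card_frames_with_range {H : Set (Fin N → Fin 2)} {S : Set (Fin n → Fin 2)}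
    {p : (Fin n → Fin 2) × (Fin N → Fin n)} (hp : p ∈ frames H S) :
    #{q ∈ frames H S | Set.range (frameMap q.1 q.2) = Set.range (frameMap p.1 p.2)} =
      #(frames H H) := by
  obtain ⟨x, d⟩ := p
  obtain ⟨hd, hS⟩ := mem_frames.1 hp
  dsimp only at hd hS
  symm
  refine card_bij (fun σ _ => (frameMap x d σ.1, d ∘ σ.2)) ?_ ?_ ?_
  · rintro ⟨u, p⟩ hσ
    obtain ⟨hp, hH⟩ := mem_frames.1 hσ
    obtain ⟨π, rfl⟩ : ∃ π : Equiv.Perm (Fin N), π = p :=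
      ⟨Equiv.ofBijective p (Finite.injective_iff_bijective.1 hp), rfl⟩
    refine mem_filter.2 ⟨mem_frames.2 ⟨hd.comp hp, fun v => ?_⟩, range_frameMap_comp_perm x d u π⟩
    rw [frameMap_frameMap_perm, hS, hH]
  · rintro ⟨u, p⟩ _ ⟨u', p'⟩ _ h
    rw [Prod.mk.injEq] at h ⊢
    exact ⟨frameMap_injective x hd h.1, hd.comp_left h.2⟩
  · rintro ⟨x', d'⟩ h
    obtain ⟨hq, hr⟩ := mem_filter.1 h
    obtain ⟨hd', hS'⟩ := mem_frames.1 hq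
    obtain ⟨u, π, rfl, rfl⟩ := exists_perm_of_range_eq hd' hr
    refine ⟨(u, π), mem_frames.2 ⟨π.injective, fun v => ?_⟩, rfl⟩
    rw [← hS' v, ← hS, frameMap_frameMap_perm]

theorem card_frames (H : Set (Fin N → Fin 2)) (S : Set (Fin n → Fin 2)) :
    #(frames H S) = #(frames H H) * copyCount H S := by
  classical
  rw [copyCount_eq_card_image, mul_comm,
    card_eq_sum_card_image (fun p => Set.range (frameMap p.1 p.2)) (frames H S), sum_const_nat]
  intro C hC
  obtain ⟨p, hp, rfl⟩ := mem_image.1 hC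
  exact card_frames_with_range hp

theorem card_frames_self_pos (H : Set (Fin N → Fin 2)) : 0 < #(frames H H) :=
  card_pos.2 ⟨(0, id), mem_frames.2 ⟨Function.injective_id, fun v => by
    rw [frameMap_id, zero_add]⟩⟩

theorem card_frames_eq_card_filter (H : Set (Fin N → Fin 2)) (S : Set (Fin n → Fin 2))
    [DecidablePred (· ∈ H)] [DecidablePred (· ∈ S)] :
    #(frames H S) = #{p : (Fin n → Fin 2) × (Fin N → Fin n) |
      Function.Injective p.2 ∧ ∀ v, frameMap p.1 p.2 v ∈ S ↔ v ∈ H} := by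
  rw [frames]
  congr!

end Count

/-- The trace of a set on a coordinatized cube `Q_N`. It is Boolean-valued so that statements about
all patterns on a small cube can be evaluated. -/
abbrev Pattern (N : ℕ) := (Fin N → Fin 2) → Bool

namespace Pattern

variable {n N : ℕ}

/-- The pattern on `Q_N` whose truth table is the binary expansion of `m`. -/
def ofCode (N m : ℕ) : Pattern N := fun v => m.testBit (finFunctionFinEquiv v)

theorem forall_of_forall_ofCode {p : Pattern N → Prop}
    (h : ∀ m : Fin (2 ^ 2 ^ N), p (ofCode N m)) (T : Pattern N) : p T := by
  let bits : Fin (2 ^ N) → Bool := fun i => T (finFunctionFinEquiv.symm i)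
  have hT : ofCode N (Nat.ofBits bits) = T := funext fun v => by
    rw [ofCode, Nat.testBit_ofBits_lt _ _ (Fin.isLt _)]
    exact congrArg T (finFunctionFinEquiv.symm_apply_apply v)
  exact hT ▸ h ⟨_, Nat.ofBits_lt_two_pow bits⟩

/-- The image of a pattern under the symmetry of the cube composed of the cyclic rotation of the
coordinates by `r` and the translation by `u`. -/
def move (u : Fin (N + 1) → Fin 2) (r : Fin (N + 1)) (T : Pattern (N + 1)) : Pattern (N + 1) :=
  fun v => T (u + fun i => v (i + r))

/-- The pattern on the facet of the cube where coordinate `i` vanishes. -/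
def face (T : Pattern (N + 1)) (i : Fin (N + 1)) : Pattern N := fun v => T (i.insertNth 0 v)

/-- The vertices of `Q_3`, listed explicitly because the kernel enumerates `Finset.univ` slowly. -/
def vertices : List (Fin 3 → Fin 2) :=
  [![0, 0, 0], ![1, 0, 0], ![0, 1, 0], ![1, 1, 0], ![0, 0, 1], ![1, 0, 1], ![0, 1, 1], ![1, 1, 1]]

theorem mem_vertices : ∀ v, v ∈ vertices := by decide

/-- The indicator of the pattern on `Q_3` that equals `H`. -/
def hit (H : Set (Fin 3 → Fin 2)) [DecidablePred (· ∈ H)] (T : Pattern 3) : ℤ :=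
  if vertices.all fun v => T v == decide (v ∈ H) then 1 else 0

theorem hit_eq_ite (H : Set (Fin 3 → Fin 2)) [DecidablePred (· ∈ H)] (T : Pattern 3) :
    hit H T = if ∀ v, T v = decide (v ∈ H) then 1 else 0 := by
  simp [hit, mem_vertices]

/-- The sum of `Φ` over the images of a pattern under the translations and the cyclic rotations of
the coordinates. -/
def orbitSum (Φ : Pattern (N + 1) → ℤ) (T : Pattern (N + 1)) : ℤ :=
  ∑ u, ∑ r, Φ (T.move u r)

theorem move_move (T : Pattern (N + 1)) (u u' : Fin (N + 1) → Fin 2) (r r' : Fin (N + 1)) :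
    (T.move u r).move u' r' = T.move (u + fun i => u' (i + r)) (r + r') :=
  funext fun v => congrArg T (funext fun i => by simp only [Pi.add_apply, add_assoc])

theorem orbitSum_move (Φ : Pattern (N + 1) → ℤ) (T : Pattern (N + 1)) (u : Fin (N + 1) → Fin 2)
    (r : Fin (N + 1)) : orbitSum Φ (T.move u r) = orbitSum Φ T :=
  Fintype.sum_equiv
    (((Equiv.addRight r).symm.arrowCongr (Equiv.refl _)).trans (Equiv.addLeft u)) _ _ fun u' =>
      Fintype.sum_equiv (Equiv.addLeft r) _ _ fun r' => congrArg Φ (move_move T u u' r r')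

/-- The sum of `Φ` over the patterns of `s` along all frames, degenerate ones included. -/
def frameSum (Φ : Pattern N → ℤ) (s : Pattern n) : ℤ :=
  ∑ d : Fin N → Fin n, ∑ x, Φ (s ∘ frameMap x d)

theorem card_frames_le_frameSum (H : Set (Fin 3 → Fin 2)) [DecidablePred (· ∈ H)]
    (S : Set (Fin n → Fin 2)) [DecidablePred (· ∈ S)] :
    (#(frames H S) : ℤ) ≤ frameSum (hit H) (fun x => decide (x ∈ S)) := by
  have hsub : #(frames H S) ≤ #{p : (Fin n → Fin 2) × (Fin 3 → Fin n) |
      ∀ v, decide (frameMap p.1 p.2 v ∈ S) = decide (v ∈ H)} := card_le_card fun p hp =>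
    mem_filter.2 ⟨mem_univ p, fun v => decide_eq_decide.2 ((mem_frames.1 hp).2 v)⟩
  refine (Nat.cast_le.2 hsub).trans_eq ?_
  rw [card_filter, Fintype.sum_prod_type_right]
  push_cast
  simp only [frameSum, hit_eq_ite]
  rfl

theorem frameSum_sum {ι : Type*} (t : Finset ι) (Φ : ι → Pattern N → ℤ) (s : Pattern n) :
    frameSum (fun T => ∑ i ∈ t, Φ i T) s = ∑ i ∈ t, frameSum (Φ i) s :=
  (sum_congr rfl fun _ _ => sum_comm).trans sum_comm

theorem frameSum_mono {Φ Ψ : Pattern N → ℤ} (h : Φ ≤ Ψ) (s : Pattern n) :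
    frameSum Φ s ≤ frameSum Ψ s :=
  sum_le_sum fun _ _ => sum_le_sum fun _ _ => h _

theorem frameSum_const (K : ℤ) (s : Pattern n) :
    frameSum (fun _ : Pattern N => K) s = K * (2 ^ n * n ^ N) := by
  simp [frameSum]
  ring

theorem move_comp_frameMap (s : Pattern n) (x : Fin n → Fin 2) (d : Fin (N + 1) → Fin n)
    (u : Fin (N + 1) → Fin 2) (r : Fin (N + 1)) :
    move u r (s ∘ frameMap x d) =
      s ∘ frameMap (frameMap x d u) (d ∘ (Equiv.addRight r).symm) := by
  funext v
  rw [Function.comp_apply, frameMap_comp_perm, ← frameMap_add]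
  rfl

theorem frameSum_move (Φ : Pattern (N + 1) → ℤ) (s : Pattern n) (u : Fin (N + 1) → Fin 2)
    (r : Fin (N + 1)) : frameSum (fun T => Φ (T.move u r)) s = frameSum Φ s := by
  simp only [frameSum, move_comp_frameMap]
  exact Fintype.sum_equiv ((Equiv.addRight r).arrowCongr (Equiv.refl _)) _ _ fun d =>
    Equiv.sum_comp (Equiv.addRight (∑ a, (Pi.single (d a) (u a) : Fin n → Fin 2)))
      fun x => Φ (s ∘ frameMap x (d ∘ (Equiv.addRight r).symm))

theorem frameSum_orbitSum (Φ : Pattern (N + 1) → ℤ) (s : Pattern n) :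
    frameSum (orbitSum Φ) s = (N + 1) * 2 ^ (N + 1) * frameSum Φ s := by
  unfold orbitSum
  simp only [frameSum_sum, frameSum_move, sum_const, card_univ, Fintype.card_pi, Fintype.card_fin,
    prod_const, nsmul_eq_mul]
  push_cast
  ring

theorem frameSum_le_of_orbitSum_le {Φ : Pattern (N + 1) → ℤ} {K : ℤ}
    (h : ∀ T, orbitSum Φ T ≤ K) (s : Pattern n) :
    (N + 1) * 2 ^ (N + 1) * frameSum Φ s ≤ K * (2 ^ n * n ^ (N + 1)) := by
  rw [← frameSum_orbitSum, ← frameSum_const]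
  exact frameSum_mono h s

theorem face_comp_frameMap (s : Pattern n) (x : Fin n → Fin 2) (d : Fin (N + 1) → Fin n)
    (i : Fin (N + 1)) : face (s ∘ frameMap x d) i = s ∘ frameMap x (i.removeNth d) :=
  funext fun v => congrArg s (frameMap_insertNth_zero x d i v)

theorem frameSum_face (Φ : Pattern N → ℤ) (i : Fin (N + 1)) (s : Pattern n) :
    frameSum (fun T => Φ (T.face i)) s = n * frameSum Φ s := by
  simp only [frameSum, face_comp_frameMap]
  rw [← (Fin.insertNthEquiv (fun _ => Fin n) i).sum_comp, Fintype.sum_prod_type]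
  simp [Fin.insertNthEquiv]

end Pattern

open Pattern

/-- A sum of squares of flag sums: for every root pattern `P` on `Q_k`, a list of pairs `(w, f)`
standing for the square with weight `w` of the sum of `f` over the extensions of `P` to `Q_{k+1}`
by one more direction. -/
abbrev SOS (k : ℕ) := Pattern k → List (ℕ × (Pattern (k + 1) → ℤ))

namespace SOS

variable {k n : ℕ}

/-- The density whose sum over all frames is the sum of squares: the product of the values at the
extensions by the first and by the second direction. -/
def eval (L : SOS k) (T : Pattern (k + 2)) : ℤ :=
  ((L ((T.face 0).face 0)).map fun c => (c.1 : ℤ) * c.2 (T.face 0) * c.2 (T.face 1)).sum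

theorem sum_sum_list_sum_mul_nonneg {ι α : Type*} [Fintype ι] (l : List (ℕ × (α → ℤ)))
    (P : ι → α) : 0 ≤ ∑ i, ∑ j, (l.map fun c => (c.1 : ℤ) * c.2 (P i) * c.2 (P j)).sum := by
  induction l with
  | nil => simp
  | cons c l ih =>
    have hsq : ∑ i, ∑ j, (c.1 : ℤ) * c.2 (P i) * c.2 (P j) = c.1 * (∑ i, c.2 (P i)) ^ 2 := by
      simp_rw [sq, sum_mul_sum, mul_sum, mul_assoc]
    simp only [List.map_cons, List.sum_cons, sum_add_distrib, hsq]
    positivity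

theorem eval_comp_frameMap (L : SOS k) (s : Pattern n) (x : Fin n → Fin 2) (d : Fin k → Fin n)
    (e e' : Fin n) :
    L.eval (s ∘ frameMap x (Fin.cons e (Fin.cons e' d))) =
      ((L (s ∘ frameMap x d)).map fun c => (c.1 : ℤ) * c.2 (s ∘ frameMap x (Fin.cons e' d)) *
        c.2 (s ∘ frameMap x (Fin.cons e d))).sum := by
  have hremove : (1 : Fin (k + 2)).removeNth (Fin.cons e (Fin.cons e' d) : Fin (k + 2) → Fin n) =
      (Fin.cons e d : Fin (k + 1) → Fin n) := funext <| Fin.cases rfl fun _ => rfl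
  simp only [eval, face_comp_frameMap, Fin.removeNth_zero, Fin.tail_cons, hremove]

theorem frameSum_eval_nonneg (L : SOS k) (s : Pattern n) : 0 ≤ frameSum L.eval s := by
  rw [frameSum, sum_comm]
  refine sum_nonneg fun x _ => ?_
  rw [← (Fin.consEquiv fun _ => Fin n).sum_comp, Fintype.sum_prod_type, sum_comm,
    ← (Fin.consEquiv fun _ => Fin n).sum_comp, Fintype.sum_prod_type, sum_comm]
  refine sum_nonneg fun d _ => ?_
  simp only [Fin.consEquiv, Equiv.coe_fn_mk, eval_comp_frameMap]
  exact sum_sum_list_sum_mul_nonneg _ fun e => s ∘ frameMap x (Fin.cons e d)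

theorem frameSum_le_of_orbitSum_add_eval_le (L : SOS k) {Φ : Pattern (k + 2) → ℤ} {B : ℤ}
    (h : ∀ T, orbitSum (fun T => Φ T + L.eval T) T ≤ (k + 2) * 2 ^ (k + 2) * B) (s : Pattern n) :
    frameSum Φ s ≤ B * (2 ^ n * n ^ (k + 2)) := by
  have hsos := L.frameSum_eval_nonneg s
  have hsum : frameSum (fun T => Φ T + L.eval T) s = frameSum Φ s + frameSum L.eval s := by
    simp only [frameSum, sum_add_distrib]
  have havg := frameSum_le_of_orbitSum_le h s
  push_cast at havg
  rw [mul_assoc (_ * _), add_assoc, one_add_one_eq_two] at havg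
  linarith [le_of_mul_le_mul_left havg (by positivity)]

end SOS

/-- The function of a pattern that takes the values `a`, `b`, `c`, `d` according to whether neither
of the vertices `v`, `w` is marked, only `v`, only `w`, or both. -/
def pairForm {N : ℕ} (v w : Fin N → Fin 2) (a b c d : ℤ) (P : Pattern N) : ℤ :=
  match P v, P w with
  | false, false => a
  | true, false => b
  | false, true => c
  | true, true => d

instance : DecidablePred (· ∈ W7) := fun v => by unfold W7; infer_instance
instance : DecidablePred (· ∈ W8) := fun v => by unfold W8; infer_instance
instance : DecidablePred (· ∈ W9) := fun v => by unfold W9; infer_instance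
instance : DecidablePred (· ∈ W10) := fun v => by unfold W10; infer_instance
instance : DecidablePred (· ∈ W12) := fun v => by unfold W12; infer_instance

/-- The sum of squares that certifies the upper bound for `W7`. -/
def sosW7 : SOS 1 := fun P =>
  match P ![0], P ![1] with
  | false, false => [(4, pairForm ![1, 0] ![1, 1] 0 1 (-1) 0)]
  | _, _ => []

/-- The sum of squares that certifies the upper bound for `W9`. -/
def sosW9 : SOS 1 := fun P =>
  match P ![0], P ![1] with
  | false, false => [(7, pairForm ![1, 0] ![1, 1] 1 2 2 (-4))]
  | true, false => [(8, pairForm ![1, 0] ![1, 1] 1 4 (-2) 1)]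
  | true, true => [(7, pairForm ![1, 0] ![1, 1] (-4) 2 2 1)]
  | false, true => []

/-- The sum of squares that certifies the upper bound for `W10`. -/
def sosW10 : SOS 1 := fun P =>
  match P ![0], P ![1] with
  | false, false => [(25, pairForm ![1, 0] ![1, 1] 1 0 0 (-1)),
      (9, pairForm ![1, 0] ![1, 1] 0 1 1 (-4)), (136, pairForm ![1, 0] ![1, 1] 0 1 (-1) 0)]
  | true, false => [(2, pairForm ![1, 0] ![1, 1] 7 1 (-5) (-4)),
      (52, pairForm ![1, 0] ![1, 1] 1 (-2) 0 0)]
  | true, true => [(1, pairForm ![1, 0] ![1, 1] 1 0 0 (-5))]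
  | false, true => []

/-- The sum of squares that certifies the upper bound for `W12`. -/
def sosW12 : SOS 1 := fun P =>
  match P ![0], P ![1] with
  | true, false => [(4, pairForm ![1, 0] ![1, 1] 1 0 0 (-1))]
  | _, _ => []

theorem card_frames_le_of_orbitSum_le {n A B : ℕ} {H : Set (Fin 3 → Fin 2)}
    [DecidablePred (· ∈ H)] (L : SOS 1)
    (h : ∀ T, orbitSum (fun T => A * hit H T + L.eval T) T ≤ 24 * B) (S : Set (Fin n → Fin 2)) :
    A * #(frames H S) ≤ B * (2 ^ n * n ^ 3) := by
  classical
  have hsum := L.frameSum_le_of_orbitSum_add_eval_le (B := B) h fun x => decide (x ∈ S)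
  simp only [frameSum, ← mul_sum] at hsum
  zify
  exact (mul_le_mul_of_nonneg_left (card_frames_le_frameSum H S) (by positivity)).trans hsum

set_option maxRecDepth 100000 in
theorem card_frames_W7_le {n : ℕ} (S : Set (Fin n → Fin 2)) :
    12 * #(frames W7 S) ≤ 2 ^ n * n ^ 3 :=
  (card_frames_le_of_orbitSum_le (B := 1) sosW7
    (forall_of_forall_ofCode (by decide +kernel)) S).trans_eq (one_mul _)

set_option maxRecDepth 100000 in
theorem card_frames_W9_le {n : ℕ} (S : Set (Fin n → Fin 2)) :
    864 * #(frames W9 S) ≤ 16 * (2 ^ n * n ^ 3) :=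
  card_frames_le_of_orbitSum_le sosW9 (forall_of_forall_ofCode (by decide +kernel)) S

set_option maxRecDepth 100000 in
theorem card_frames_W10_le {n : ℕ} (S : Set (Fin n → Fin 2)) :
    1440 * #(frames W10 S) ≤ 25 * (2 ^ n * n ^ 3) :=
  card_frames_le_of_orbitSum_le sosW10 (forall_of_forall_ofCode (by decide +kernel)) S

set_option maxRecDepth 100000 in
theorem card_frames_W12_le {n : ℕ} (S : Set (Fin n → Fin 2)) :
    16 * #(frames W12 S) ≤ 2 ^ n * n ^ 3 :=
  (card_frames_le_of_orbitSum_le (B := 1) sosW12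
    (forall_of_forall_ofCode (by decide +kernel)) S).trans_eq (one_mul _)

/-- The sum of squares that certifies the upper bound for `W8`. Its roots are the squares marked on
one diagonal, so it is a density on `Q_4`. -/
def sosW8 : SOS 2 := fun P =>
  match P ![0, 0], P ![1, 0], P ![0, 1], P ![1, 1] with
  | false, true, true, false => [(1, pairForm ![1, 0, 0] ![1, 1, 1] 0 1 (-1) 0)]
  | true, false, false, true => [(1, pairForm ![1, 1, 0] ![1, 0, 1] 0 1 (-1) 0)]
  | _, _, _, _ => []

theorem eval_sosW8_le_one (T : Pattern 4) : sosW8.eval T ≤ 1 := by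
  have hmul : ∀ {v w : Fin 3 → Fin 2} (P Q : Pattern 3),
      pairForm v w 0 1 (-1) 0 P * pairForm v w 0 1 (-1) 0 Q ≤ 1 := fun P Q => by
    unfold pairForm
    split <;> split <;> norm_num
  unfold SOS.eval sosW8
  split <;> simp [hmul]

/-- The pattern whose facets in the first direction carry `P` and `Q`. -/
def stack {N : ℕ} (P Q : Pattern N) : Pattern (N + 1) :=
  fun v => if v 0 = 0 then P (Fin.tail v) else Q (Fin.tail v)

theorem stack_face_zero {N : ℕ} (T : Pattern (N + 1)) :
    stack (T.face 0) (fun v => T (Fin.cons 1 v)) = T := by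
  have hone : ∀ t : Fin 2, t ≠ 0 → t = 1 := by decide
  funext v
  unfold stack face
  split_ifs with h
  · rw [Fin.insertNth_zero', ← h, Fin.cons_self_tail]
  · beta_reduce
    rw [← hone _ h, Fin.cons_self_tail]

set_option maxRecDepth 100000 in
theorem orbitSum_stack_W8_le (Q : Pattern 3) :
    orbitSum (fun T => 12 * hit W8 (T.face 0) + sosW8.eval T)
      (stack (fun v => decide (v ∈ W8)) Q) ≤ 64 :=
  forall_of_forall_ofCode (p := fun Q => orbitSum _ (stack _ Q) ≤ 64) (by decide +kernel) Q

theorem orbitSum_W8_le (T : Pattern 4) :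
    orbitSum (fun T => 12 * hit W8 (T.face 0) + sosW8.eval T) T ≤ 64 := by
  by_cases h : ∃ u r, (T.move u r).face 0 = fun v => decide (v ∈ W8)
  · obtain ⟨u, r, h⟩ := h
    rw [← orbitSum_move _ T u r, ← stack_face_zero (T.move u r), h]
    exact orbitSum_stack_W8_le _
  · have hhit (u r) : hit W8 ((T.move u r).face 0) = 0 := by
      rw [hit_eq_ite, if_neg fun hv => h ⟨u, r, funext hv⟩]
    calc orbitSum (fun T => 12 * hit W8 (T.face 0) + sosW8.eval T) T
      _ ≤ ∑ _ : Fin 4 → Fin 2, ∑ _ : Fin 4, 1 := sum_le_sum fun u _ => sum_le_sum fun r _ => by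
          simpa only [hhit, mul_zero, zero_add] using eval_sosW8_le_one _
      _ = 64 := by simp

theorem card_frames_W8_le {n : ℕ} (S : Set (Fin n → Fin 2)) :
    12 * #(frames W8 S) ≤ 2 ^ n * n ^ 3 := by
  classical
  obtain rfl | hn := n.eq_zero_or_pos
  · simp [frames, Function.Injective]
  have hQ4 := sosW8.frameSum_le_of_orbitSum_add_eval_le (B := 1) orbitSum_W8_le
    fun x => decide (x ∈ S)
  have hface : frameSum (fun T : Pattern 4 => 12 * hit W8 (T.face 0)) (fun x => decide (x ∈ S)) =
      12 * (n * frameSum (hit W8) fun x => decide (x ∈ S)) := by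
    rw [← frameSum_face (hit W8) 0]
    simp only [frameSum, mul_sum]
  have hle := card_frames_le_frameSum W8 S
  zify
  refine le_of_mul_le_mul_left (a := (n : ℤ)) ?_ (by exact_mod_cast hn)
  calc (n : ℤ) * (12 * #(frames W8 S))
    _ ≤ 12 * (n * frameSum (hit W8) fun x => decide (x ∈ S)) := by
        rw [mul_left_comm]
        gcongr
    _ ≤ 1 * (2 ^ n * n ^ 4) := hface ▸ hQ4
    _ = n * (2 ^ n * n ^ 3) := by ring

section Cayley

variable {G : Type*} [AddCommGroup G] {n N : ℕ}

/-- The map from `Q_n` to a Cayley graph that sends the origin to `0` and moves by `y i` along the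
coordinate `i`. -/
def cayleyMap (y : Fin n → G) (x : Fin n → Fin 2) : G := ∑ i, (x i).val • y i

/-- The set of vertices of `Q_n` sent into `A` by the map `cayleyMap y` started at `h`. -/
def cayleySet (A : Set G) (h : G) (y : Fin n → G) : Set (Fin n → Fin 2) :=
  {x | h + cayleyMap y x ∈ A}

/-- The steps seen from the vertex `x`: there, moving along `i` undoes `y i` if `x i = 1`. -/
def reflect {K : Finset G} (hK : ∀ g ∈ K, -g ∈ K) (x : Fin n → Fin 2) : Equiv.Perm (Fin n → K) :=
  Equiv.piCongrRight fun i => if x i = 0 then Equiv.refl K else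
    Function.Involutive.toPerm (fun g => ⟨-g, hK g g.2⟩) fun g => Subtype.ext (neg_neg (g : G))

theorem reflect_apply {K : Finset G} (hK : ∀ g ∈ K, -g ∈ K) (x : Fin n → Fin 2) (y : Fin n → K)
    (i : Fin n) : (reflect hK x y i : G) = if x i = 0 then (y i : G) else -y i := by
  unfold reflect
  rw [Equiv.piCongrRight_apply, Pi.map_apply]
  split_ifs <;> rfl

theorem cayleyMap_add {K : Finset G} (hK : ∀ g ∈ K, -g ∈ K) (y : Fin n → K)
    (x z : Fin n → Fin 2) : cayleyMap (fun i => (y i : G)) (x + z) =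
      cayleyMap (fun i => (y i : G)) x + cayleyMap (fun i => (reflect hK x y i : G)) z := by
  have hval (s t : Fin 2) (g : G) :
      (s + t).val • g = s.val • g + t.val • (if s = 0 then g else -g) := by
    fin_cases s <;> fin_cases t <;> simp
  simp only [cayleyMap, Pi.add_apply, hval, sum_add_distrib, reflect_apply]

theorem cayleyMap_frameMap_zero (y : Fin n → G) {d : Fin N → Fin n} (hd : Function.Injective d)
    (v : Fin N → Fin 2) : cayleyMap y (frameMap 0 d v) = cayleyMap (y ∘ d) v :=
  (Fintype.sum_of_injective d hd _ _
    (fun i hi => by simp [frameMap_apply_of_notMem_range 0 v hi])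
    fun a => by simp [frameMap_apply 0 hd]).symm

theorem card_pow_mul_sum_comp {κ : Type*} [Fintype κ] {d : Fin N → Fin n}
    (hd : Function.Injective d) (f : (Fin N → κ) → ℕ) :
    Fintype.card κ ^ N * ∑ y : Fin n → κ, f (y ∘ d) = Fintype.card κ ^ n * ∑ t, f t := by
  have hinv : Function.Involutive fun p : (Fin n → κ) × (Fin N → κ) =>
      (Function.extend d p.2 p.1, p.1 ∘ d) := fun p => by
    refine Prod.ext (funext fun i => ?_) (Function.extend_comp hd _ _)
    by_cases hi : ∃ a, d a = i
    · obtain ⟨a, rfl⟩ := hi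
      exact hd.extend_apply _ _ a
    · simp only [Function.extend_apply' _ _ _ hi]
  have hsum := Equiv.sum_comp hinv.toPerm fun p => f p.2
  simpa [Fintype.sum_prod_type, Function.Involutive.coe_toPerm, sum_comm (γ := Fin n → κ),
    ← mul_sum] using hsum

theorem card_pow_mul_sum_sum_reflect {K : Finset G} (hK : ∀ g ∈ K, -g ∈ K) [Fintype G]
    (x : Fin n → Fin 2) {d : Fin N → Fin n} (hd : Function.Injective d)
    (f : G × (Fin N → K) → ℕ) :
    #K ^ N * ∑ y : Fin n → K, ∑ h,
      f (h + cayleyMap (fun i => (y i : G)) x, reflect hK x y ∘ d) = #K ^ n * ∑ p, f p := by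
  have hshift (y : Fin n → K) : ∑ h, f (h + cayleyMap (fun i => (y i : G)) x, reflect hK x y ∘ d) =
      ∑ h, f (h, reflect hK x y ∘ d) :=
    Equiv.sum_comp (Equiv.addRight (cayleyMap (fun i => (y i : G)) x)) fun h => f (h, _)
  have hcomp := card_pow_mul_sum_comp hd fun t : Fin N → K => ∑ h, f (h, t)
  rw [Fintype.card_coe] at hcomp
  simp only [hshift]
  rw [Equiv.sum_comp (reflect hK x) fun y => ∑ h, f (h, y ∘ d), hcomp, Fintype.sum_prod_type_right]

variable [Fintype G]

/-- The starting points and steps for which the pullback of `A` to `Q_N` is `H`. -/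
def cayleyFrames (K : Finset G) (A : Set G) (H : Set (Fin N → Fin 2)) [DecidablePred (· ∈ A)]
    [DecidablePred (· ∈ H)] : Finset (G × (Fin N → K)) :=
  {p | ∀ v, p.1 + cayleyMap (fun a => (p.2 a : G)) v ∈ A ↔ v ∈ H}

variable {K : Finset G} {A : Set G} {H : Set (Fin N → Fin 2)} [DecidablePred (· ∈ A)]
  [DecidablePred (· ∈ H)]

theorem mem_frames_cayleySet (hK : ∀ g ∈ K, -g ∈ K) (h : G) (y : Fin n → K) (x : Fin n → Fin 2)
    (d : Fin N → Fin n) :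
    (x, d) ∈ frames H (cayleySet A h fun i => (y i : G)) ↔ Function.Injective d ∧
      (h + cayleyMap (fun i => (y i : G)) x, reflect hK x y ∘ d) ∈ cayleyFrames K A H := by
  rw [mem_frames, cayleyFrames, mem_filter_univ]
  refine and_congr_right fun hd => forall_congr' fun v => ?_
  have hx : frameMap x d v = x + frameMap 0 d v := by simp [frameMap]
  rw [cayleySet, Set.mem_ofPred_eq, hx, cayleyMap_add hK, ← add_assoc,
    cayleyMap_frameMap_zero _ hd]
  rfl

theorem card_frames_cayleySet [DecidableEq G] (hK : ∀ g ∈ K, -g ∈ K) (h : G) (y : Fin n → K) :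
    #(frames H (cayleySet A h fun i => (y i : G))) = ∑ d : Fin N → Fin n with Function.Injective d,
      ∑ x, if (h + cayleyMap (fun i => (y i : G)) x, reflect hK x y ∘ d) ∈ cayleyFrames K A H
        then 1 else 0 := by
  classical
  rw [← filter_univ_mem (frames H _), card_filter, Fintype.sum_prod_type_right, sum_filter]
  refine sum_congr rfl fun d _ => ?_
  simp only [mem_frames_cayleySet hK, ite_and]
  split_ifs <;> simp

theorem sum_card_frames_cayleySet (hK : ∀ g ∈ K, -g ∈ K) (n : ℕ) :
    #K ^ N * ∑ p : G × (Fin n → K), #(frames H (cayleySet A p.1 fun i => (p.2 i : G))) =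
      #K ^ n * (#(cayleyFrames K A H) * (2 ^ n * n.descFactorial N)) := by
  classical
  have hinj : #{d : Fin N → Fin n | Function.Injective d} = n.descFactorial N := by
    rw [← Fintype.card_subtype, Fintype.card_congr (Equiv.subtypeInjectiveEquivEmbedding _ _),
      Fintype.card_embedding_eq, Fintype.card_fin, Fintype.card_fin]
  have hterm (d : Fin N → Fin n) (hd : d ∈ ({d | Function.Injective d} : Finset _)) :
      #K ^ N * ∑ p : G × (Fin n → K), ∑ x, (if (p.1 + cayleyMap (fun i => (p.2 i : G)) x,
        reflect hK x p.2 ∘ d) ∈ cayleyFrames K A H then 1 else 0) =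
      2 ^ n * (#K ^ n * #(cayleyFrames K A H)) := by
    rw [sum_comm, mul_sum]
    simp only [Fintype.sum_prod_type_right (α₁ := G)]
    simp only [card_pow_mul_sum_sum_reflect hK _ (mem_filter.1 hd).2
      fun p => if p ∈ cayleyFrames K A H then 1 else 0]
    simp
  simp only [card_frames_cayleySet hK]
  rw [sum_comm, mul_sum, sum_congr rfl hterm, sum_const, hinj, smul_eq_mul]
  ring

theorem exists_mul_le_card_frames (hK : ∀ g ∈ K, -g ∈ K) (hne : K.Nonempty) (n : ℕ) :
    ∃ S : Set (Fin n → Fin 2), #(cayleyFrames K A H) * (2 ^ n * n.descFactorial N) ≤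
      Fintype.card G * #K ^ N * #(frames H S) := by
  have := hne.coe_sort
  obtain ⟨p, -, hp⟩ := exists_le_of_sum_le univ_nonempty (s := (univ : Finset (G × (Fin n → K))))
    (f := fun _ => #(cayleyFrames K A H) * (2 ^ n * n.descFactorial N))
    (g := fun p => Fintype.card G * #K ^ N *
      #(frames H (cayleySet A p.1 fun i => (p.2 i : G)))) <| by
    rw [sum_const, ← mul_sum, mul_assoc, sum_card_frames_cayleySet hK]
    simp [mul_assoc]
  exact ⟨_, hp⟩

end Cayley

section Limit

open Filter Topology Nat

variable {n N : ℕ} {H : Set (Fin N → Fin 2)}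

theorem copyCount_le_inducibility (H : Set (Fin N → Fin 2)) (S : Set (Fin n → Fin 2)) :
    copyCount H S ≤ inducibility H n := by
  classical
  simpa [inducibility] using le_sup
    (f := fun S : Finset (Fin n → Fin 2) => copyCount H (S : Set (Fin n → Fin 2)))
    (mem_univ S.toFinset)

theorem exists_inducibility_eq_copyCount (H : Set (Fin N → Fin 2)) (n : ℕ) :
    ∃ S : Set (Fin n → Fin 2), inducibility H n = copyCount H S :=
  let ⟨S, _, hS⟩ := exists_mem_eq_sup univ univ_nonempty
    fun S : Finset (Fin n → Fin 2) => copyCount H (S : Set (Fin n → Fin 2))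
  ⟨S, hS⟩

theorem two_pow_mul_factorial_mul_card_subcubes (h : N ≤ n) :
    2 ^ N * N ! * (n.choose N * 2 ^ (n - N)) = 2 ^ n * n.descFactorial N := by
  rw [descFactorial_eq_factorial_mul_choose, ← Nat.pow_sub_mul_pow 2 h]
  ring

theorem tendsto_pow_div_descFactorial (N : ℕ) :
    Tendsto (fun n : ℕ => (n : ℝ) ^ N / n.descFactorial N) atTop (𝓝 1) := by
  refine (Asymptotics.isEquivalent_iff_tendsto_one ?_).1 (isEquivalent_descFactorial N).symm
  filter_upwards [eventually_ge_atTop N] with n hn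
  exact_mod_cast (Nat.descFactorial_pos.2 hn).ne'

theorem tendsto_frame_density {a : ℝ}
    (hup : ∀ n (S : Set (Fin n → Fin 2)), (#(frames H S) : ℝ) ≤ a * (2 ^ n * n ^ N))
    (hlow : ∀ n, ∃ S : Set (Fin n → Fin 2), a * (2 ^ n * n.descFactorial N) ≤ #(frames H S)) :
    Tendsto (fun n => (#(frames H H) * inducibility H n : ℝ) / (2 ^ n * n.descFactorial N))
      atTop (𝓝 a) := by
  refine tendsto_of_tendsto_of_tendsto_of_le_of_le' tendsto_const_nhds
    (by simpa using (tendsto_pow_div_descFactorial N).const_mul a) ?_ ?_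
  all_goals
    filter_upwards [eventually_ge_atTop N] with n hn
    have hpos : (0 : ℝ) < n.descFactorial N := by exact_mod_cast Nat.descFactorial_pos.2 hn
  · obtain ⟨S, hS⟩ := hlow n
    rw [le_div_iff₀ (by positivity)]
    refine hS.trans ?_
    rw [card_frames]
    exact_mod_cast Nat.mul_le_mul_left _ (copyCount_le_inducibility H S)
  · obtain ⟨S, hS⟩ := exists_inducibility_eq_copyCount H n
    rw [hS, ← Nat.cast_mul, ← card_frames, div_le_iff₀ (by positivity)]
    refine (hup n S).trans_eq ?_
    field_simp

theorem hasInducibilityConstant_of_bounds {a : ℝ}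
    (hup : ∀ n (S : Set (Fin n → Fin 2)), (#(frames H S) : ℝ) ≤ a * (2 ^ n * n ^ N))
    (hlow : ∀ n, ∃ S : Set (Fin n → Fin 2), a * (2 ^ n * n.descFactorial N) ≤ #(frames H S)) :
    HasInducibilityConstant H (2 ^ N * N ! / #(frames H H) * a) := by
  refine ((tendsto_frame_density hup hlow).const_mul (2 ^ N * N ! / #(frames H H) : ℝ)).congr' ?_
  filter_upwards [eventually_ge_atTop N] with n hn
  have hself : (0 : ℝ) < #(frames H H) := by exact_mod_cast card_frames_self_pos H
  have hchoose : (0 : ℝ) < n.choose N := by exact_mod_cast Nat.choose_pos hn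
  have hcubes : (2 ^ n * n.descFactorial N : ℝ) = 2 ^ N * N ! * (n.choose N * 2 ^ (n - N)) := by
    exact_mod_cast (two_pow_mul_factorial_mul_card_subcubes hn).symm
  rw [hcubes]
  field_simp

theorem hasInducibilityConstant_of_card_cayleyFrames {G : Type*} [AddCommGroup G] [Fintype G]
    {K : Finset G} {A : Set G} [DecidablePred (· ∈ A)] [DecidablePred (· ∈ H)] {s m q : ℕ}
    (hK : ∀ g ∈ K, -g ∈ K) (hne : K.Nonempty) (hs : #(frames H H) = s)
    (hm : Fintype.card G * #K ^ N = m) (hq : #(cayleyFrames K A H) = q)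
    (hup : ∀ n (S : Set (Fin n → Fin 2)), m * #(frames H S) ≤ q * (2 ^ n * n ^ N)) :
    HasInducibilityConstant H (2 ^ N * N ! / s * (q / m)) := by
  have hpos : (0 : ℝ) < m := by
    rw [← hm]
    exact_mod_cast Nat.mul_pos Fintype.card_pos (pow_pos hne.card_pos N)
  rw [← hs]
  refine hasInducibilityConstant_of_bounds (fun n S => ?_) fun n => ?_
  · rw [div_mul_eq_mul_div, le_div_iff₀' hpos]
    exact_mod_cast hup n S
  · obtain ⟨S, hS⟩ := exists_mul_le_card_frames (A := A) (H := H) hK hne n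
    rw [hm, hq] at hS
    refine ⟨S, ?_⟩
    rw [div_mul_eq_mul_div, div_le_iff₀' hpos]
    exact_mod_cast hS

end Limit

theorem hasInducibilityConstant_W7 : HasInducibilityConstant W7 (1 / 3) := by
  have hself : #(frames W7 W7) = 12 := by
    rw [card_frames_eq_card_filter]
    decide +kernel
  have hcount : #(cayleyFrames {1, -1} ({1} : Set (ZMod 3)) W7) = 2 := by decide +kernel
  have h := hasInducibilityConstant_of_card_cayleyFrames (m := 24) (by decide) (by decide) hself
    (by decide) hcount fun n S => by linarith [card_frames_W7_le S]
  norm_num [Nat.factorial] at h ⊢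
  exact h

theorem hasInducibilityConstant_W8 : HasInducibilityConstant W8 (2 / 3) := by
  have hself : #(frames W8 W8) = 6 := by
    rw [card_frames_eq_card_filter]
    decide +kernel
  have hcount : #(cayleyFrames {1, -1} ({1} : Set (ZMod 3)) W8) = 2 := by decide +kernel
  have h := hasInducibilityConstant_of_card_cayleyFrames (m := 24) (by decide) (by decide) hself
    (by decide) hcount fun n S => by linarith [card_frames_W8_le S]
  norm_num [Nat.factorial] at h ⊢
  exact h

theorem hasInducibilityConstant_W9 : HasInducibilityConstant W9 (4 / 9) := by
  have hself : #(frames W9 W9) = 2 := by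
    rw [card_frames_eq_card_filter]
    decide +kernel
  have hcount : #(cayleyFrames {(1, 0), (0, 1), (0, -1)}
      ({(0, 0), (0, 1), (1, 2), (1, 3)} : Set (ZMod 2 × ZMod 4)) W9) = 4 := by decide +kernel
  have h := hasInducibilityConstant_of_card_cayleyFrames (m := 216) (by decide) (by decide) hself
    (by decide) hcount fun n S => by linarith [card_frames_W9_le S]
  norm_num [Nat.factorial] at h ⊢
  exact h

theorem hasInducibilityConstant_W12 : HasInducibilityConstant W12 (1 / 2) := by
  have hself : #(frames W12 W12) = 6 := by
    rw [card_frames_eq_card_filter]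
    decide +kernel
  have hcount : #(cayleyFrames {1, -1} ({0, 1} : Set (ZMod 4)) W12) = 2 := by decide +kernel
  have h := hasInducibilityConstant_of_card_cayleyFrames (m := 32) (by decide) (by decide) hself
    (by decide) hcount fun n S => by linarith [card_frames_W12_le S]
  norm_num [Nat.factorial] at h ⊢
  exact h

/-- The additive group `(ℤ/2)^5`, realized by binary words under bitwise exclusive or because the
kernel computes with these quickly. -/
def Xor5 : Type := BitVec 5

namespace Xor5

instance : DecidableEq Xor5 := inferInstanceAs (DecidableEq (BitVec 5))
instance : Fintype Xor5 := Fintype.ofEquiv _ (BitVec.equivFin (m := 5)).symm.toEquiv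
instance (m : ℕ) : OfNat Xor5 m := ⟨BitVec.ofNat 5 m⟩
instance : Add Xor5 := ⟨BitVec.xor⟩
instance : Zero Xor5 := ⟨BitVec.zero 5⟩
instance : Neg Xor5 := ⟨id⟩

instance : AddCommGroup Xor5 where
  __ := AddGroup.ofLeftAxioms (G := Xor5) BitVec.xor_assoc (fun _ => BitVec.zero_xor)
    fun _ => BitVec.xor_self
  add_comm := BitVec.xor_comm

/-- The unit words and the all-ones word. Their Cayley graph is the folded `6`-cube, the quotient of
`Q_6` by the antipodal map. -/
def generators : Finset Xor5 := {1, 2, 4, 8, 16, 31}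

/-- The set of vertices of the folded `6`-cube whose pullbacks to `Q_n` are extremal for `W10`. A
vertex in it has one neighbour in it, a vertex outside it has three. -/
def extremalSet : Set Xor5 := {0, 1, 6, 10, 13, 15, 19, 20, 23, 25, 26, 28}

-- The binary digits of `379102275` mark the elements of `extremalSet`.
instance (g : Xor5) : Decidable (g ∈ extremalSet) :=
  decidable_of_iff (Nat.testBit 379102275 (BitVec.toNat g)) <| by
    unfold extremalSet
    revert g
    decide

end Xor5

open Xor5 in
theorem hasInducibilityConstant_W10 : HasInducibilityConstant W10 (5 / 12) := by
  have hself : #(frames W10 W10) = 2 := by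
    rw [card_frames_eq_card_filter]
    decide +kernel
  have hcount : #(cayleyFrames generators extremalSet W10) = 120 := by decide +kernel
  have h := hasInducibilityConstant_of_card_cayleyFrames (m := 6912) (by decide) (by decide) hself
    (by decide) hcount fun n S => by linarith [card_frames_W10_le S]
  norm_num [Nat.factorial] at h ⊢
  exact h

end Hypercube

theorem theorem1 :
    Hypercube.HasInducibilityConstant Hypercube.W7 (1 / 3) ∧
    Hypercube.HasInducibilityConstant Hypercube.W8 (2 / 3) ∧
    Hypercube.HasInducibilityConstant Hypercube.W9 (4 / 9) ∧
    Hypercube.HasInducibilityConstant Hypercube.W10 (5 / 12) ∧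
    Hypercube.HasInducibilityConstant Hypercube.W12 (1 / 2) :=
  ⟨Hypercube.hasInducibilityConstant_W7, Hypercube.hasInducibilityConstant_W8,
    Hypercube.hasInducibilityConstant_W9, Hypercube.hasInducibilityConstant_W10,
    Hypercube.hasInducibilityConstant_W12⟩
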